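/- Let $\mathbb{D}=\{z\in\mathbb{C}:|z|<1\}$ and $\mathbb{T}=\{z\in\mathbb{C}:|z|=1\}$. Let $B_{\mathbb{C}}$ be a standard complex Brownian motion, i.e. its real and imaginary parts are independent standard real Brownian motions started from $0$. For $\rho\in\mathbb{T}$ let $$P_\rho(z)=\operatorname{Re}\frac{1+z/\rho}{1-z/\rho},\qquad z\in\mathbb{D},$$ be the normalized Poisson kernel with pole at $\rho$, and write $2\partial_{\overline z}=\partial_x+i\partial_y$. Almost surely, let $\delta_\rho(t)$, $0\le t<\tau_\rho$, with $\tau_\rho\in(0,\infty]$, be the maximal solution (i.e. the one that cannot be extended beyond $\tau_\rho$) of the ODE $$\delta_\rho'(t)=\frac{2\partial_{\overline z}P_\rho}{P_\rho}\bigl(\delta_\rho(t)+B_{\mathbb{C}}(t)\bigr),\qquad \delta_\rho(0)=0,$$ where $\delta_\rho(t)+B_{\mathbb{C}}(t)$ is required to stay in $\mathbb{D}$, and put $B_{\mathbb{C}}^\rho(t)=B_{\mathbb{C}}(t)+\delta_\rho(t)$ for $0\le t<\tau_\rho$. Regard $(B_{\mathbb{C}}^\rho(t):0\le t<\tau_\rho)$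 as a random element of the space of continuous curves $\gamma:[0,T)\to\mathbb{D}$, $T\in(0,\infty]$, $\gamma(0)=0$, with the $\sigma$-algebra generated by the events $\{t<T,\ \gamma(t)\in A\}$, for $t\ge 0$ and $A\subseteq\mathbb{C}$ Borel. Then for any $\rho_1,\rho_2\in\mathbb{T}$, the random curve $\bigl(B_{\mathbb{C}}^{\rho_2}(t):0\le t<\tau_{\rho_2}\bigr)$ has the same distribution as $\bigl(R_{\rho_2/\rho_1}\circ B_{\mathbb{C}}^{\rho_1}(t):0\le t<\tau_{\rho_1}\bigr)$, where $R_{\rho_2/\rho_1}$ is the rotation $z\mapsto z\,\rho_2/\rho_1$. -/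

import Mathlib

open MeasureTheory ProbabilityTheory Set Metric
open scoped NNReal ENNReal Topology

/-- A standard complex Brownian motion: its real and imaginary parts are independent standard real
Brownian motions (started from `0`, with almost surely continuous paths). -/
structure IsStandardComplexBrownian {Ω : Type*} [MeasurableSpace Ω] (B : ℝ≥0 → Ω → ℂ)
    (P : Measure Ω) : Prop where
  re : IsBrownianReal (fun t ω ↦ (B t ω).re) P
  im : IsBrownianReal (fun t ω ↦ (B t ω).im) P
  indep : IndepFun (fun ω t ↦ (B t ω).re) (fun ω t ↦ (B t ω).im) P

/-- The operator `2 ∂_{z̄} = ∂_x + i ∂_y` applied to a real valued function on the plane. -/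
noncomputable def twoDbar (f : ℂ → ℝ) (z : ℂ) : ℂ :=
  (fderiv ℝ f z 1 : ℂ) + Complex.I * (fderiv ℝ f z Complex.I : ℂ)

/-- The normalized Poisson kernel in the unit disk with pole at `1`. -/
noncomputable def poissonOne (z : ℂ) : ℝ := ((1 + z) / (1 - z)).re

/-- The normalized Poisson kernel in the unit disk with pole at `ρ`. -/
noncomputable def poissonAt (ρ : Circle) (z : ℂ) : ℝ := poissonOne (z / ρ)

/-- The drift `2 ∂_{z̄} P_ρ / P_ρ`. -/
noncomputable def poissonDrift (ρ : Circle) (z : ℂ) : ℂ :=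
  twoDbar (poissonAt ρ) z / (poissonAt ρ z : ℂ)

/-- A continuous curve `γ(t)`, `0 ≤ t < T`, in the unit disk, started from `0`, with lifetime
`T ∈ (0, ∞]`.  The value of `toFun` at times `t ≥ T` has no meaning, and is set to `0` so that
two curves are equal exactly when they have the same lifetime and agree before it. -/
@[ext] structure DiskCurve where
  lifetime : ℝ≥0∞
  toFun : ℝ≥0 → ℂ
  lifetime_pos : 0 < lifetime
  continuousOn : ContinuousOn toFun {t | (t : ℝ≥0∞) < lifetime}
  map_zero : toFun 0 = 0
  norm_lt_one : ∀ t : ℝ≥0, (t : ℝ≥0∞) < lifetime → ‖toFun t‖ < 1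
  eq_zero : ∀ t : ℝ≥0, lifetime ≤ (t : ℝ≥0∞) → toFun t = 0

namespace DiskCurve

/-- The σ-algebra on the space of curves generated by the coordinates: it is generated by the
events `{t < T, γ(t) ∈ A}` for `t ≥ 0` and Borel sets `A`. -/
instance : MeasurableSpace DiskCurve :=
  MeasurableSpace.generateFrom
    {S | ∃ (t : ℝ≥0) (A : Set ℂ), MeasurableSet A ∧
      S = {γ : DiskCurve | (t : ℝ≥0∞) < γ.lifetime ∧ γ.toFun t ∈ A}}

/-- The curve that stays at `0` forever. -/
instance : Inhabited DiskCurve :=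
  ⟨{ lifetime := ⊤, toFun := fun _ ↦ 0, lifetime_pos := by simp,
     continuousOn := continuousOn_const, map_zero := rfl,
     norm_lt_one := by simp, eq_zero := by simp }⟩

/-- The composition `R_a ∘ γ` of a curve with the rotation `R_a : z ↦ z a`. -/
def rotate (a : Circle) (γ : DiskCurve) : DiskCurve where
  lifetime := γ.lifetime
  toFun t := γ.toFun t * a
  lifetime_pos := γ.lifetime_pos
  continuousOn := γ.continuousOn.mul continuousOn_const
  map_zero := by simp [γ.map_zero]
  norm_lt_one t ht := by
    rw [norm_mul, Circle.norm_coe, mul_one]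
    exact γ.norm_lt_one t ht
  eq_zero t ht := by simp [γ.eq_zero t ht]

/-- For a driving path `w`, the curve `γ` is `w + δ` on `[0, T)`, where `δ` solves the ODE
`δ'(t) = (2 ∂_{z̄} P_ρ / P_ρ)(δ(t) + w(t))`, `0 ≤ t < T`, with `δ(0) = 0`
(and the derivative at `0` is the right derivative). -/
def IsSolution (ρ : Circle) (w : ℝ≥0 → ℂ) (γ : DiskCurve) : Prop :=
  γ.toFun 0 - w 0 = 0 ∧
  ∀ t : ℝ≥0, (t : ℝ≥0∞) < γ.lifetime →
    HasDerivWithinAt (fun s : ℝ ↦ γ.toFun s.toNNReal - w s.toNNReal)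
      (poissonDrift ρ (γ.toFun t)) (Ici 0) (t : ℝ)

/-- The solution cannot be extended beyond its lifetime. -/
def IsMaximalSolution (ρ : Circle) (w : ℝ≥0 → ℂ) (γ : DiskCurve) : Prop :=
  γ.IsSolution ρ w ∧
  ∀ γ' : DiskCurve, γ'.IsSolution ρ w →
    (∀ t : ℝ≥0, (t : ℝ≥0∞) < γ.lifetime → γ'.toFun t = γ.toFun t) → γ'.lifetime ≤ γ.lifetime

end DiskCurve

/-! ### Existence and uniqueness of the maximal solution for a continuous driving path -/

theorem poissonAt_pos (ρ : Circle) {z : ℂ} (hz : ‖z‖ < 1) : 0 < poissonAt ρ z := by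
  have hz' : ‖z / ρ‖ < 1 := by simpa only [norm_div, Circle.norm_coe, div_one] using hz
  set u : ℂ := z / ρ with hu
  have h1 : (1 - u) ≠ 0 := by
    intro h
    rw [← sub_eq_zero.1 h] at hz'
    simp at hz'
  have h2 : 0 < Complex.normSq (1 - u) := Complex.normSq_pos.2 h1
  have h3 : Complex.normSq u < 1 := by
    rw [Complex.normSq_eq_norm_sq]
    nlinarith [norm_nonneg u]
  rw [poissonAt, poissonOne, ← hu, Complex.div_re, ← add_div]
  apply div_pos _ h2
  rw [Complex.normSq_apply] at h3
  simp
  nlinarith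

theorem contDiffOn_poissonAt (ρ : Circle) : ContDiffOn ℝ 2 (poissonAt ρ) (ball 0 1) := by
  have h1 : ∀ z ∈ ball (0 : ℂ) 1, 1 - z / (ρ : ℂ) ≠ 0 := by
    intro z hz h
    have h' : ‖z / (ρ : ℂ)‖ < 1 := by
      simpa only [norm_div, Circle.norm_coe, div_one, mem_ball_zero_iff] using hz
    rw [← sub_eq_zero.1 h] at h'
    simp at h'
  unfold poissonAt poissonOne
  have h2 : ContDiffOn ℝ 2 (fun z : ℂ ↦ (1 + z / (ρ : ℂ)) / (1 - z / (ρ : ℂ))) (ball 0 1) := by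
    simp only [div_eq_mul_inv] at h1 ⊢
    exact ContDiffOn.mul (by fun_prop) (ContDiffOn.inv (by fun_prop) h1)
  exact Complex.reCLM.contDiff.comp_contDiffOn h2

theorem contDiffOn_poissonDrift (ρ : Circle) : ContDiffOn ℝ 1 (poissonDrift ρ) (ball 0 1) := by
  have h := contDiffOn_poissonAt ρ
  have h1 : ContDiffOn ℝ 1 (fderiv ℝ (poissonAt ρ)) (ball 0 1) :=
    h.fderiv_of_isOpen isOpen_ball (by norm_num)
  have h2 (v : ℂ) : ContDiffOn ℝ 1 (fun z ↦ ((fderiv ℝ (poissonAt ρ) z v : ℝ) : ℂ)) (ball 0 1) :=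
    Complex.ofRealCLM.contDiff.comp_contDiffOn (h1.clm_apply contDiffOn_const)
  have h3 : ContDiffOn ℝ 1 (fun z ↦ ((poissonAt ρ z : ℝ) : ℂ)) (ball 0 1) :=
    Complex.ofRealCLM.contDiff.comp_contDiffOn (h.of_le (by norm_num))
  unfold poissonDrift twoDbar
  simp only [div_eq_mul_inv]
  refine ((h2 1).add (contDiffOn_const.mul (h2 Complex.I))).mul (h3.inv fun z hz ↦ ?_)
  exact_mod_cast (poissonAt_pos ρ (by simpa using hz)).ne'

namespace DiskCurve

/-- Two solutions agree as long as both live. -/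
theorem IsSolution.eq_of_lt {ρ : Circle} {w : ℝ≥0 → ℂ} {γ γ' : DiskCurve}
    (h : γ.IsSolution ρ w) (h' : γ'.IsSolution ρ w) {t : ℝ≥0}
    (ht : (t : ℝ≥0∞) < γ.lifetime) (ht' : (t : ℝ≥0∞) < γ'.lifetime) :
    γ.toFun t = γ'.toFun t := by
  have key (η : DiskCurve) (hη : (t : ℝ≥0∞) < η.lifetime) :
      ∃ r < 1, ∀ s : ℝ≥0, s ≤ t → ‖η.toFun s‖ ≤ r := by
    have hc : ContinuousOn (fun s ↦ ‖η.toFun s‖) (Icc 0 t) :=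
      (η.continuousOn.mono fun s hs ↦
        lt_of_le_of_lt (ENNReal.coe_le_coe.2 hs.2) hη).norm
    obtain ⟨s₀, hs₀, hmax⟩ := isCompact_Icc.exists_isMaxOn (nonempty_Icc.2 (zero_le (a := t))) hc
    exact ⟨_, η.norm_lt_one s₀ (lt_of_le_of_lt (ENNReal.coe_le_coe.2 hs₀.2) hη),
      fun s hs ↦ hmax ⟨zero_le, hs⟩⟩
  obtain ⟨r₁, hr₁, hb₁⟩ := key γ ht
  obtain ⟨r₂, hr₂, hb₂⟩ := key γ' ht'
  set r := max r₁ r₂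
  have hr : r < 1 := max_lt hr₁ hr₂
  obtain ⟨K, hK⟩ := ((contDiffOn_poissonDrift ρ).mono (closedBall_subset_ball hr)
    ).exists_lipschitzOnWith one_ne_zero (convex_closedBall _ _) (isCompact_closedBall _ _)
  have hd (η : DiskCurve) (hη : η.IsSolution ρ w) (hl : (t : ℝ≥0∞) < η.lifetime) (s : ℝ)
      (hs : s ∈ Icc 0 (t : ℝ)) :
      HasDerivWithinAt (fun s : ℝ ↦ η.toFun s.toNNReal - w s.toNNReal)
        (poissonDrift ρ (η.toFun s.toNNReal - w s.toNNReal + w s.toNNReal)) (Ici 0) s := by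
    have := hη.2 s.toNNReal
      (lt_of_le_of_lt (ENNReal.coe_le_coe.2 (Real.toNNReal_le_iff_le_coe.2 hs.2)) hl)
    simpa [hs.1] using this
  have hu := ODE_solution_unique_of_mem_Icc_right
    (v := fun (s : ℝ) x ↦ poissonDrift ρ (x + w s.toNNReal))
    (s := fun s : ℝ ↦ {x | x + w s.toNNReal ∈ closedBall 0 r}) (K := K)
    (f := fun s : ℝ ↦ γ.toFun s.toNNReal - w s.toNNReal)
    (g := fun s : ℝ ↦ γ'.toFun s.toNNReal - w s.toNNReal) (a := 0) (b := t)
    (fun s _ ↦ LipschitzOnWith.of_dist_le_mul fun x hx y hy ↦ by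
      simpa using hK.dist_le_mul _ hx _ hy)
    (fun s hs ↦ ((hd γ h ht s hs).continuousWithinAt).mono Icc_subset_Ici_self)
    (fun s hs ↦ (hd γ h ht s ⟨hs.1, hs.2.le⟩).mono (Ici_subset_Ici.2 hs.1))
    (fun s hs ↦ by
      simpa only [mem_ofPred_eq, sub_add_cancel, mem_closedBall_zero_iff] using
        (hb₁ s.toNNReal (Real.toNNReal_le_iff_le_coe.2 hs.2.le)).trans (le_max_left r₁ r₂))
    (fun s hs ↦ ((hd γ' h' ht' s hs).continuousWithinAt).mono Icc_subset_Ici_self)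
    (fun s hs ↦ (hd γ' h' ht' s ⟨hs.1, hs.2.le⟩).mono (Ici_subset_Ici.2 hs.1))
    (fun s hs ↦ by
      simpa only [mem_ofPred_eq, sub_add_cancel, mem_closedBall_zero_iff] using
        (hb₂ s.toNNReal (Real.toNNReal_le_iff_le_coe.2 hs.2.le)).trans (le_max_right r₁ r₂))
    (by simp [γ.map_zero, γ'.map_zero])
  have := hu (x := t) ⟨t.2, le_rfl⟩
  simpa using this

/-- Local existence. -/
theorem exists_isSolution (ρ : Circle) {w : ℝ≥0 → ℂ} (hw : Continuous w) (hw0 : w 0 = 0) :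
    ∃ γ : DiskCurve, γ.IsSolution ρ w := by
  have hsub : closedBall (0 : ℂ) (1 / 2) ⊆ ball 0 1 := closedBall_subset_ball (by norm_num)
  have hcd := (contDiffOn_poissonDrift ρ).mono hsub
  obtain ⟨K, hK⟩ := hcd.exists_lipschitzOnWith one_ne_zero (convex_closedBall _ _)
    (isCompact_closedBall _ _)
  obtain ⟨M, hM⟩ := (isCompact_closedBall (0 : ℂ) (1 / 2)).exists_bound_of_continuousOn
    hcd.continuousOn
  have hwc : Continuous fun s : ℝ ↦ w s.toNNReal := hw.comp continuous_real_toNNReal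
  obtain ⟨ε₀, hε₀, hwε⟩ := Metric.continuousAt_iff.1 (hwc.continuousAt (x := 0)) (1 / 4) (by norm_num)
  simp only [Real.toNNReal_zero, hw0, dist_zero_right, Real.norm_eq_abs] at hwε
  set L : ℝ≥0 := M.toNNReal + 1
  have hL : (0 : ℝ) < L := by positivity
  set ε : ℝ := min (ε₀ / 2) (1 / 4 / L)
  have hε : 0 < ε := lt_min (by positivity) (by positivity)
  have hmem : ∀ t ∈ Icc 0 ε, ∀ x ∈ closedBall (0 : ℂ) (1 / 4 : ℝ≥0),
      x + w t.toNNReal ∈ closedBall (0 : ℂ) (1 / 2) := by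
    intro t ht x hx
    have h1 := hwε (x := t) (by
      rw [abs_of_nonneg ht.1]
      have := ht.2.trans (min_le_left _ _)
      linarith)
    have h2 : ‖x‖ ≤ 1 / 4 := by simpa using hx
    rw [mem_closedBall_zero_iff]
    have := norm_add_le x (w t.toNNReal)
    linarith
  have hPL : IsPicardLindelof (fun (t : ℝ) x ↦ poissonDrift ρ (x + w t.toNNReal))
      (tmin := 0) (tmax := ε) ⟨0, le_rfl, hε.le⟩ (0 : ℂ) (1 / 4 : ℝ≥0) 0 L K := by
    refine ⟨fun t ht ↦ ?_, fun x hx ↦ ?_, fun t ht x hx ↦ ?_, ?_⟩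
    · exact LipschitzOnWith.of_dist_le_mul fun x hx y hy ↦ by
        simpa using hK.dist_le_mul _ (hmem t ht x hx) _ (hmem t ht y hy)
    · exact hcd.continuousOn.comp (continuous_const.add hwc).continuousOn
        fun t ht ↦ hmem t ht x hx
    · refine (hM _ (hmem t ht x hx)).trans ((Real.le_coe_toNNReal M).trans ?_)
      simp [L]
    · have h1 : ε ≤ 1 / 4 / L := min_le_right _ _
      rw [le_div_iff₀ hL] at h1
      simp only [sub_zero, sub_self, max_eq_left hε.le]
      push_cast
      linarith
  obtain ⟨α, hα0, hα⟩ := hPL.exists_eq_forall_mem_Icc_hasDerivWithinAt₀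
  simp only at hα0
  have hαc : ContinuousOn α (Icc 0 ε) := fun t ht ↦ (hα t ht).continuousWithinAt
  have hβc : ContinuousOn (fun s : ℝ ↦ α s + w s.toNNReal) (Icc 0 ε) := hαc.add hwc.continuousOn
  obtain ⟨ε₁, hε₁, hβ⟩ := Metric.continuousWithinAt_iff.1 (hβc 0 ⟨le_rfl, hε.le⟩) 1 one_pos
  simp only [hα0, Real.toNNReal_zero, hw0, add_zero, dist_zero_right, Real.norm_eq_abs] at hβ
  set ε₂ : ℝ≥0 := (min ε ε₁).toNNReal
  have hm : 0 < min ε ε₁ := lt_min hε hε₁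
  have hlt : ∀ t : ℝ≥0, (t : ℝ≥0∞) < (ε₂ : ℝ≥0∞) → (t : ℝ) < ε ∧ (t : ℝ) < ε₁ := by
    intro t ht
    have := Real.lt_toNNReal_iff_coe_lt.1 (ENNReal.coe_lt_coe.1 ht)
    exact lt_min_iff.1 this
  classical
  refine ⟨{
    lifetime := ε₂
    toFun := fun t ↦ if (t : ℝ≥0∞) < ε₂ then α t + w t else 0
    lifetime_pos := by simpa [ε₂] using ⟨hε, hε₁⟩
    continuousOn := ?_
    map_zero := by simp [hα0, hw0]
    norm_lt_one := ?_
    eq_zero := fun t ht ↦ by simp [not_lt.2 ht] }, ?_, ?_⟩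
  · refine ContinuousOn.congr (f := fun t : ℝ≥0 ↦ α t + w t) ?_ fun t ht ↦ if_pos ht
    refine ContinuousOn.add ?_ hw.continuousOn
    exact hαc.comp NNReal.continuous_coe.continuousOn fun t ht ↦ ⟨t.2, (hlt t ht).1.le⟩
  · intro t ht
    have := hβ (x := t) ⟨t.2, (hlt t ht).1.le⟩ (by simpa using (hlt t ht).2)
    simpa [ht] using this
  · simp [hα0, hw0]
  · intro t ht
    have h1 := hα t ⟨t.2, (hlt t ht).1.le⟩
    have hnear : ∀ᶠ s : ℝ in 𝓝[Ici 0] (t : ℝ), s < ε ∧ s < ε₁ :=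
      nhdsWithin_le_nhds ((eventually_lt_nhds (hlt t ht).1).and (eventually_lt_nhds (hlt t ht).2))
    have h2 : HasDerivWithinAt α (poissonDrift ρ (α t + w t)) (Ici 0) t := by
      rw [Real.toNNReal_coe] at h1
      refine h1.mono_of_mem_nhdsWithin ?_
      filter_upwards [hnear, self_mem_nhdsWithin] with s hs hs0 using ⟨hs0, hs.1.le⟩
    simp only at ht
    simp only [if_pos ht]
    refine h2.congr_of_eventuallyEq ?_ (by simp [ht])
    filter_upwards [hnear, self_mem_nhdsWithin] with s hs hs0
    have : ((s.toNNReal : ℝ≥0) : ℝ≥0∞) < ε₂ :=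
      ENNReal.coe_lt_coe.2 (Real.toNNReal_lt_toNNReal_iff hm |>.2 (lt_min hs.1 hs.2))
    rw [if_pos this]
    simp [Real.coe_toNNReal s hs0]

/-- For a continuous driving path started from `0` there is exactly one maximal solution. -/
theorem existsUnique_isMaximalSolution (ρ : Circle) {w : ℝ≥0 → ℂ} (hw : Continuous w)
    (hw0 : w 0 = 0) : ∃! γ : DiskCurve, γ.IsMaximalSolution ρ w := by
  classical
  obtain ⟨γ₀, hγ₀⟩ := exists_isSolution ρ hw hw0
  set T : ℝ≥0∞ := ⨆ γ : {γ : DiskCurve // γ.IsSolution ρ w}, γ.1.lifetime with hT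
  have hex : ∀ t : ℝ≥0, (t : ℝ≥0∞) < T →
      ∃ γ : DiskCurve, γ.IsSolution ρ w ∧ (t : ℝ≥0∞) < γ.lifetime := by
    intro t ht
    obtain ⟨γ, hγ⟩ := lt_iSup_iff.1 ht
    exact ⟨γ.1, γ.2, hγ⟩
  have hle : ∀ γ : DiskCurve, γ.IsSolution ρ w → γ.lifetime ≤ T := fun γ hγ ↦
    le_iSup (fun γ : {γ : DiskCurve // γ.IsSolution ρ w} ↦ γ.1.lifetime) ⟨γ, hγ⟩
  set F : ℝ≥0 → ℂ := fun t ↦ if h : (t : ℝ≥0∞) < T then (hex t h).choose.toFun t else 0 with hF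
  have hFe : ∀ γ : DiskCurve, γ.IsSolution ρ w → ∀ t : ℝ≥0, (t : ℝ≥0∞) < γ.lifetime →
      F t = γ.toFun t := by
    intro γ hγ t ht
    have h := lt_of_lt_of_le ht (hle γ hγ)
    simp only [hF, dif_pos h]
    exact (hex t h).choose_spec.1.eq_of_lt hγ (hex t h).choose_spec.2 ht
  have hopen : ∀ γ : DiskCurve, IsOpen {t : ℝ≥0 | (t : ℝ≥0∞) < γ.lifetime} := fun γ ↦
    isOpen_lt ENNReal.continuous_coe continuous_const
  let Γ : DiskCurve := {
    lifetime := T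
    toFun := F
    lifetime_pos := lt_of_lt_of_le γ₀.lifetime_pos (hle γ₀ hγ₀)
    continuousOn := by
      intro t ht
      obtain ⟨γ, hγ, htγ⟩ := hex t ht
      have h1 : ContinuousAt γ.toFun t := γ.continuousOn.continuousAt ((hopen γ).mem_nhds htγ)
      refine (h1.congr ?_).continuousWithinAt
      filter_upwards [(hopen γ).mem_nhds htγ] with s hs using (hFe γ hγ s hs).symm
    map_zero := by rw [hFe γ₀ hγ₀ 0 (by simpa using γ₀.lifetime_pos), γ₀.map_zero]
    norm_lt_one := by
      intro t ht
      obtain ⟨γ, hγ, htγ⟩ := hex t ht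
      rw [hFe γ hγ t htγ]
      exact γ.norm_lt_one t htγ
    eq_zero := fun t ht ↦ by simp only [hF, dif_neg (not_lt.2 ht)] }
  have hΓ : Γ.IsSolution ρ w := by
    refine ⟨by simp [Γ.map_zero, hw0], fun t ht ↦ ?_⟩
    obtain ⟨γ, hγ, htγ⟩ := hex t ht
    have h1 := hγ.2 t htγ
    have h2 : Γ.toFun t = γ.toFun t := hFe γ hγ t htγ
    rw [h2]
    refine h1.congr_of_eventuallyEq ?_ (by simp [h2])
    have h3 : ∀ᶠ s : ℝ in 𝓝 (t : ℝ), ((s.toNNReal : ℝ≥0) : ℝ≥0∞) < γ.lifetime := by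
      have : ContinuousAt Real.toNNReal (t : ℝ) := continuous_real_toNNReal.continuousAt
      exact this.eventually (by rw [Real.toNNReal_coe]; exact (hopen γ).mem_nhds htγ)
    filter_upwards [nhdsWithin_le_nhds h3] with s hs
    change F _ - _ = _
    rw [hFe γ hγ _ hs]
  refine ⟨Γ, ⟨hΓ, fun γ hγ _ ↦ hle γ hγ⟩, ?_⟩
  rintro γ ⟨hγ, hmax⟩
  have hl : γ.lifetime = T :=
    le_antisymm (hle γ hγ) (hmax Γ hΓ fun t ht ↦ hFe γ hγ t ht)
  ext t
  · exact hl
  · by_cases ht : (t : ℝ≥0∞) < γ.lifetime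
    · exact (hFe γ hγ t ht).symm
    · rw [γ.eq_zero t (not_lt.1 ht), Γ.eq_zero t (by simpa [Γ, hl] using ht)]

end DiskCurve

open Classical in
/-- The conditioned path `B^ρ(t) = w(t) + δ_ρ(t)`, `0 ≤ t < τ_ρ`, as a function of the driving path
`w`: the unique maximal solution.  Paths that are not continuous or do not start from `0` form a
null set for Brownian motion, and are assigned a default value. -/
noncomputable def conditionedPath (ρ : Circle) (w : ℝ≥0 → ℂ) : DiskCurve :=
  if h : Continuous w ∧ w 0 = 0 then
    (DiskCurve.existsUnique_isMaximalSolution ρ h.1 h.2).choose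
  else default

theorem isMaximalSolution_conditionedPath (ρ : Circle) {w : ℝ≥0 → ℂ} (hw : Continuous w)
    (hw0 : w 0 = 0) : (conditionedPath ρ w).IsMaximalSolution ρ w := by
  rw [conditionedPath, dif_pos ⟨hw, hw0⟩]
  exact (DiskCurve.existsUnique_isMaximalSolution ρ hw hw0).choose_spec.1

/-! The law of `B` is invariant under rotation about `0`, and the ODE is equivariant. Put `a = ρ₂ /
ρ₁`. Since `P_{ρa}(za) = P_ρ(z)`, the drift satisfies `poissonDrift (ρ * a) (z * a) = a *
poissonDrift ρ z`, so rotating a maximal solution with pole `ρ₁` driven by `w` gives a maximal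
solution with pole `ρ₂` driven by `w * a`. By uniqueness, `conditionedPath ρ₂ (w * a)` is the
rotation of `conditionedPath ρ₁ w` (`conditionedPath_mul`). Since `B` and `B * a` have the same law
(`mul_circle`, `identDistrib`), applying `conditionedPath ρ₂` to both gives the claim.

The last step needs `conditionedPath ρ₂` to be a measurable map (`measurable_conditionedPath`), and
this is most of the work. The drift blows up at the unit circle, so it is replaced on smaller disks
by bounded Lipschitz fields. Their solutions are limits of Picard iterates, hence measurable in the
driving path, and each generating event for the maximal solution is a countable union of events
about these auxiliary solutions. -/

/-! ### Rotation invariance and uniqueness of the law of complex Brownian motion. -/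

namespace ProbabilityTheory

/-- Two independent Gaussian processes are jointly Gaussian. -/
theorem IsGaussianProcess.sumElim {Ω S T : Type*} [MeasurableSpace Ω] {P : Measure Ω}
    {X : S → Ω → ℝ} {Y : T → Ω → ℝ} (hX : IsGaussianProcess X P) (hY : IsGaussianProcess Y P)
    (h : IndepFun (fun ω s ↦ X s ω) (fun ω t ↦ Y t ω) P) :
    IsGaussianProcess (Sum.elim X Y) P where
  hasGaussianLaw I := by
    -- A finite index set in the disjoint union splits into its two sides. The two restrictions are
    -- independent Gaussian vectors, so their pair is Gaussian, and `L` below merely reindexes it.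
    have h' : IndepFun (fun ω ↦ I.toLeft.restrict (X · ω)) (fun ω ↦ I.toRight.restrict (Y · ω)) P :=
      h.comp (Finset.measurable_restrict _) (Finset.measurable_restrict _)
    have hg := h'.hasGaussianLaw (hX.hasGaussianLaw I.toLeft) (hY.hasGaussianLaw I.toRight)
    let L : (I.toLeft → ℝ) × (I.toRight → ℝ) →L[ℝ] (I → ℝ) :=
      ContinuousLinearMap.pi fun i ↦ match i with
        | ⟨Sum.inl s, hs⟩ => (ContinuousLinearMap.proj (R := ℝ) (φ := fun _ : I.toLeft ↦ ℝ)
            ⟨s, Finset.mem_toLeft.2 hs⟩).comp (ContinuousLinearMap.fst ℝ _ _)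
        | ⟨Sum.inr t, ht⟩ => (ContinuousLinearMap.proj (R := ℝ) (φ := fun _ : I.toRight ↦ ℝ)
            ⟨t, Finset.mem_toRight.2 ht⟩).comp (ContinuousLinearMap.snd ℝ _ _)
    have e : (fun ω ↦ I.restrict (Sum.elim X Y · ω)) =
        L ∘ fun ω ↦ (I.toLeft.restrict (X · ω), I.toRight.restrict (Y · ω)) := by
      refine funext fun ω ↦ funext ?_
      rintro ⟨s | t, hi⟩ <;> simp [L]
    rw [e]
    exact hg.map L

/-- Rotating a pair of independent pre-Brownian motions yields another such pair. -/
theorem IsPreBrownianReal.rotation {Ω : Type*} [MeasurableSpace Ω] {P : Measure Ω}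
    {X Y : ℝ≥0 → Ω → ℝ} (hX : IsPreBrownianReal X P) (hY : IsPreBrownianReal Y P)
    (h : IndepFun (fun ω t ↦ X t ω) (fun ω t ↦ Y t ω) P) {c s : ℝ} (hcs : c ^ 2 + s ^ 2 = 1) :
    IsPreBrownianReal (fun t ω ↦ c * X t ω - s * Y t ω) P ∧
      IsPreBrownianReal (fun t ω ↦ s * X t ω + c * Y t ω) P ∧
      IndepFun (fun ω t ↦ c * X t ω - s * Y t ω) (fun ω t ↦ s * X t ω + c * Y t ω) P := by
  have hP := hX.isGaussianProcess.isProbabilityMeasure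
  have hG := hX.isGaussianProcess.sumElim hY.isGaussianProcess h
  have mX (t) : MemLp (X t) 2 P := (hX.isGaussianProcess.hasGaussianLaw_eval t).memLp_two
  have mY (t) : MemLp (Y t) 2 P := (hY.isGaussianProcess.hasGaussianLaw_eval t).memLp_two
  have hc (t u) : cov[X t, Y u; P] = 0 :=
    (h.comp (measurable_pi_apply t) (measurable_pi_apply u)).covariance_eq_zero (mX t) (mY u)
  have cXX (a b a' b' : ℝ) (t u : ℝ≥0) :
      cov[fun ω ↦ a * X t ω + b * Y t ω, fun ω ↦ a' * X u ω + b' * Y u ω; P]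
        = (a * a' + b * b') * min t u := by
    have e1 : (fun ω ↦ a * X t ω + b * Y t ω) = a • X t + b • Y t := rfl
    have e2 : (fun ω ↦ a' * X u ω + b' * Y u ω) = a' • X u + b' • Y u := rfl
    rw [e1, e2, covariance_add_left ((mX t).const_smul a) ((mY t).const_smul b)
      (((mX u).const_smul a').add ((mY u).const_smul b')),
      covariance_add_right ((mX t).const_smul a) ((mX u).const_smul a') ((mY u).const_smul b'),
      covariance_add_right ((mY t).const_smul b) ((mX u).const_smul a') ((mY u).const_smul b')]
    simp only [covariance_smul_left, covariance_smul_right, hc, covariance_comm (Y t) (X u),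
      hX.covariance_eval, hY.covariance_eval]
    push_cast
    ring
  have hjoint : IsGaussianProcess (Sum.elim (fun t ω ↦ c * X t ω + (-s) * Y t ω)
      (fun t ω ↦ s * X t ω + c * Y t ω)) P := by
    have lin (a b : ℝ) (t : ℝ≥0) : ∃ I : Finset (ℝ≥0 ⊕ ℝ≥0), ∃ L : (I → ℝ) →L[ℝ] ℝ,
        ∀ ω, a * X t ω + b * Y t ω = L (I.restrict ((Sum.elim X Y) · ω)) := by
      refine ⟨{.inl t, .inr t}, a • ContinuousLinearMap.proj ⟨.inl t, by simp⟩ +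
        b • ContinuousLinearMap.proj ⟨.inr t, by simp⟩, fun ω ↦ by simp⟩
    refine hG.of_isGaussianProcess ?_
    rintro (t | t)
    · exact lin c (-s) t
    · exact lin s c t
  have hmean (a b : ℝ) (t : ℝ≥0) : P[fun ω ↦ a * X t ω + b * Y t ω] = 0 := by
    rw [integral_add ((hX.integrable_eval t).const_mul a) ((hY.integrable_eval t).const_mul b),
      integral_const_mul, integral_const_mul, hX.integral_eval, hY.integral_eval]
    simp
  simp only [sub_eq_add_neg, ← neg_mul]
  refine ⟨?_, ?_, ?_⟩
  · refine (hjoint.comp_right Sum.inl).isPreBrownianReal_of_covariance (hmean c (-s)) ?_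
    intro t u htu
    refine (cXX _ _ _ _ t u).trans ?_
    rw [min_eq_left htu]
    linear_combination (t : ℝ) * hcs
  · refine (hjoint.comp_right Sum.inr).isPreBrownianReal_of_covariance (hmean s c) ?_
    intro t u htu
    refine (cXX _ _ _ _ t u).trans ?_
    rw [min_eq_left htu]
    linear_combination (t : ℝ) * hcs
  -- For jointly Gaussian processes, vanishing cross-covariance is independence; here it is `(c * s
  -- - s * c) * min t u = 0`.
  · refine hjoint.indepFun_of_covariance_eq_zero (hjoint.aemeasurable <| .inl ·)
      (hjoint.aemeasurable <| .inr ·) fun t u ↦ ?_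
    rw [cXX]
    ring

end ProbabilityTheory

namespace IsStandardComplexBrownian

variable {Ω : Type*} [MeasurableSpace Ω] {P : Measure Ω} {B B' : ℝ≥0 → Ω → ℂ}

theorem isProbabilityMeasure (hB : IsStandardComplexBrownian B P) : IsProbabilityMeasure P :=
  hB.re.isGaussianProcess.isProbabilityMeasure

theorem aemeasurable (hB : IsStandardComplexBrownian B P) (t : ℝ≥0) : AEMeasurable (B t) P := by
  have h := (Complex.measurable_ofReal.comp_aemeasurable (hB.re.aemeasurable t)).add
    ((Complex.measurable_ofReal.comp_aemeasurable (hB.im.aemeasurable t)).mul_const Complex.I)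
  refine h.congr (.of_forall fun ω ↦ ?_)
  simp

theorem continuous_ae (hB : IsStandardComplexBrownian B P) : ∀ᵐ ω ∂P, Continuous (B · ω) := by
  filter_upwards [hB.re.cont, hB.im.cont] with ω h1 h2
  have : (B · ω) = fun t ↦ ((B t ω).re : ℂ) + (B t ω).im * Complex.I := by simp
  rw [this]
  fun_prop

theorem zero_ae (hB : IsStandardComplexBrownian B P) : ∀ᵐ ω ∂P, B 0 ω = 0 := by
  filter_upwards [hB.re.eval_zero_ae_eq_zero, hB.im.eval_zero_ae_eq_zero] with ω h1 h2
  exact Complex.ext h1 h2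

/-- Rotation invariance of complex Brownian motion. -/
theorem mul_circle (hB : IsStandardComplexBrownian B P) (a : Circle) :
    IsStandardComplexBrownian (fun t ω ↦ B t ω * a) P := by
  have hcs : (a : ℂ).re ^ 2 + (a : ℂ).im ^ 2 = 1 := by
    have := Circle.normSq_coe a
    rw [Complex.normSq_apply] at this
    linarith
  obtain ⟨h1, h2, h3⟩ := hB.re.toIsPreBrownianReal.rotation hB.im.toIsPreBrownianReal hB.indep hcs
  have e1 : (fun (t : ℝ≥0) ω ↦ (B t ω * a).re) =
      fun t ω ↦ (a : ℂ).re * (B t ω).re - (a : ℂ).im * (B t ω).im := by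
    ext; simp only [Complex.mul_re]; ring
  have e2 : (fun (t : ℝ≥0) ω ↦ (B t ω * a).im) =
      fun t ω ↦ (a : ℂ).im * (B t ω).re + (a : ℂ).re * (B t ω).im := by
    ext; simp only [Complex.mul_im]; ring
  refine ⟨⟨e1 ▸ h1, ?_⟩, ⟨e2 ▸ h2, ?_⟩, ?_⟩
  · filter_upwards [hB.continuous_ae] with ω h
    exact Complex.continuous_re.comp (h.mul continuous_const)
  · filter_upwards [hB.continuous_ae] with ω h
    exact Complex.continuous_im.comp (h.mul continuous_const)
  · convert h3 using 3 with ω t ω t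
    · exact congrFun₂ e1 t ω
    · exact congrFun₂ e2 t ω

/-- Allows `B` to be replaced by a measurable version with continuous paths. -/
theorem congr (hB : IsStandardComplexBrownian B P) (h : ∀ᵐ ω ∂P, ∀ t, B t ω = B' t ω) :
    IsStandardComplexBrownian B' P where
  re := ⟨hB.re.toIsPreBrownianReal.congr fun t ↦ by filter_upwards [h] with ω h using by simp [h],
    by filter_upwards [h, hB.re.cont] with ω h h' using by simpa [h] using h'⟩
  im := ⟨hB.im.toIsPreBrownianReal.congr fun t ↦ by filter_upwards [h] with ω h using by simp [h],
    by filter_upwards [h, hB.im.cont] with ω h h' using by simpa [h] using h'⟩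
  indep := hB.indep.congr (by filter_upwards [h] with ω h using by simp [h])
    (by filter_upwards [h] with ω h using by simp [h])

/-- Complex Brownian motions with measurable coordinates have the same law. -/
theorem identDistrib (hB : IsStandardComplexBrownian B P) (hB' : IsStandardComplexBrownian B' P)
    (hm : ∀ t, Measurable (B t)) (hm' : ∀ t, Measurable (B' t)) :
    IdentDistrib (fun ω t ↦ B t ω) (fun ω t ↦ B' t ω) P P := by
  have hP := hB.isProbabilityMeasure
  have key {X Y : ℝ≥0 → Ω → ℝ} (hX : IsPreBrownianReal X P) (hY : IsPreBrownianReal Y P)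
      (mX : ∀ t, Measurable (X t)) (mY : ∀ t, Measurable (Y t)) :
      IdentDistrib (fun ω t ↦ X t ω) (fun ω t ↦ Y t ω) P P := by
    refine (identDistrib_iff_forall_finset_identDistrib (measurable_pi_lambda _ mX).aemeasurable
      (measurable_pi_lambda _ mY).aemeasurable).2 fun I ↦ ?_
    exact (hX.hasLaw I).identDistrib (hY.hasLaw I)
  -- Independence turns equality of the two marginal laws into equality of the joint laws of real
  -- and imaginary parts; `hu` then reassembles the complex path.
  have h := (key hB.re.toIsPreBrownianReal hB'.re.toIsPreBrownianReal
    (fun t ↦ Complex.measurable_re.comp (hm t)) (fun t ↦ Complex.measurable_re.comp (hm' t))).prodMk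
    (key hB.im.toIsPreBrownianReal hB'.im.toIsPreBrownianReal
    (fun t ↦ Complex.measurable_im.comp (hm t)) (fun t ↦ Complex.measurable_im.comp (hm' t)))
    hB.indep hB'.indep
  have hu : Measurable fun (p : (ℝ≥0 → ℝ) × (ℝ≥0 → ℝ)) (t : ℝ≥0) ↦
      (p.1 t : ℂ) + p.2 t * Complex.I := by
    refine measurable_pi_lambda _ fun t ↦ ?_
    fun_prop
  convert h.comp hu using 1 <;> ext <;> simp

end IsStandardComplexBrownian

/-! ### Equivariance of the drift and of maximal solutions under rotation. -/

theorem poissonAt_mul (ρ a : Circle) (z : ℂ) : poissonAt (ρ * a) (z * a) = poissonAt ρ z := by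
  rw [poissonAt, poissonAt, Circle.coe_mul, mul_div_mul_right _ _ (Circle.coe_ne_zero a)]

/-- The operator `2 ∂_{z̄}` is covariant under rotations. -/
theorem twoDbar_mul_circle {f g : ℂ → ℝ} (a : Circle) (h : ∀ z, f (z * a) = g z) {z : ℂ}
    (hf : DifferentiableAt ℝ f (z * a)) : twoDbar f (z * a) = a * twoDbar g z := by
  have hL : HasFDerivAt (fun z : ℂ ↦ z * (a : ℂ))
      ((a : ℂ) • (ContinuousLinearMap.id ℝ ℂ)) z := by
    simpa using (hasFDerivAt_id (𝕜 := ℝ) z).mul_const' (a : ℂ)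
  have hg : fderiv ℝ g z = (fderiv ℝ f (z * a)).comp ((a : ℂ) • ContinuousLinearMap.id ℝ ℂ) := by
    have := (hf.hasFDerivAt.comp z hL).fderiv
    rwa [show f ∘ (fun z : ℂ ↦ z * (a : ℂ)) = g from funext h] at this
  have hlin (u : ℂ) : fderiv ℝ f (z * a) u =
      u.re * fderiv ℝ f (z * a) 1 + u.im * fderiv ℝ f (z * a) Complex.I := by
    conv_lhs => rw [show u = u.re • (1 : ℂ) + u.im • Complex.I by simp]
    rw [map_add, map_smul, map_smul, smul_eq_mul, smul_eq_mul]
  rw [twoDbar, twoDbar, hg]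
  simp only [ContinuousLinearMap.comp_apply, _root_.smul_apply,
    ContinuousLinearMap.id_apply, smul_eq_mul, mul_one]
  rw [hlin a, hlin (a * Complex.I)]
  have hn : (a : ℂ).re * (a : ℂ).re + (a : ℂ).im * (a : ℂ).im = 1 := by
    rw [← Complex.normSq_apply, Circle.normSq_coe]
  set p := fderiv ℝ f (z * a) 1
  set q := fderiv ℝ f (z * a) Complex.I
  -- By the chain rule, `twoDbar g z` is `conj a * (p + i q)`, so the claim comes down to `a * conj
  -- a = 1`.
  apply Complex.ext
  · simp
    linear_combination (-p) * hn
  · simp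
    linear_combination (-q) * hn

theorem poissonDrift_mul (ρ a : Circle) {z : ℂ} (hz : ‖z‖ < 1) :
    poissonDrift (ρ * a) (z * a) = a * poissonDrift ρ z := by
  have hd : DifferentiableAt ℝ (poissonAt (ρ * a)) (z * a) :=
    ((contDiffOn_poissonAt _).differentiableOn (by norm_num)).differentiableAt
      (isOpen_ball.mem_nhds (by simpa [Circle.norm_coe] using hz))
  rw [poissonDrift, poissonDrift, poissonAt_mul, twoDbar_mul_circle a (poissonAt_mul ρ a) hd,
    mul_div_assoc]

namespace DiskCurve

theorem IsSolution.rotate {ρ : Circle} {w : ℝ≥0 → ℂ} {γ : DiskCurve} (h : γ.IsSolution ρ w)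
    (a : Circle) : (γ.rotate a).IsSolution (ρ * a) (fun t ↦ w t * a) := by
  refine ⟨?_, fun t ht ↦ ?_⟩
  · simp only [DiskCurve.rotate]
    rw [← sub_mul, h.1, zero_mul]
  · have h1 := (h.2 t ht).mul_const (a : ℂ)
    simp only [DiskCurve.rotate]
    rw [poissonDrift_mul ρ a (γ.norm_lt_one t ht), mul_comm]
    simpa only [sub_mul] using h1

/-- Rotation by `a⁻¹` turns a competitor of the rotated curve into a competitor of `γ` with the same
lifetime, so maximality carries over. -/
theorem IsMaximalSolution.rotate {ρ : Circle} {w : ℝ≥0 → ℂ} {γ : DiskCurve}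
    (h : γ.IsMaximalSolution ρ w) (a : Circle) :
    (γ.rotate a).IsMaximalSolution (ρ * a) (fun t ↦ w t * a) := by
  refine ⟨h.1.rotate a, fun γ' hγ' he ↦ ?_⟩
  have h1 := hγ'.rotate a⁻¹
  simp only [mul_inv_cancel_right, Circle.coe_inv,
    mul_inv_cancel_right₀ (Circle.coe_ne_zero a)] at h1
  refine h.2 (γ'.rotate a⁻¹) h1 fun t ht ↦ ?_
  simp only [DiskCurve.rotate, he t ht, Circle.coe_inv,
    mul_inv_cancel_right₀ (Circle.coe_ne_zero a)]

end DiskCurve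

theorem conditionedPath_mul (ρ a : Circle) {w : ℝ≥0 → ℂ} (hw : Continuous w) (hw0 : w 0 = 0) :
    conditionedPath (ρ * a) (fun t ↦ w t * a) = (conditionedPath ρ w).rotate a := by
  have hc : Continuous fun t ↦ w t * (a : ℂ) := hw.mul continuous_const
  have h0 : w 0 * (a : ℂ) = 0 := by rw [hw0, zero_mul]
  exact (DiskCurve.existsUnique_isMaximalSolution (ρ * a) hc h0).unique
    (isMaximalSolution_conditionedPath _ hc h0)
    ((isMaximalSolution_conditionedPath ρ hw hw0).rotate a)

/-! ### Auxiliary Lipschitz equations and measurability of their solutions. -/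

/-- Every solution is at most as long as the maximal one. -/
theorem DiskCurve.IsSolution.lifetime_le {ρ : Circle} {w : ℝ≥0 → ℂ} {γ γ' : DiskCurve}
    (h : γ.IsSolution ρ w) (h' : γ'.IsMaximalSolution ρ w) : γ.lifetime ≤ γ'.lifetime := by
  by_contra! hlt
  -- A strictly longer solution would extend `γ'`, by uniqueness on the common lifetime.
  exact hlt.not_ge <| h'.2 γ h fun t ht ↦ h.eq_of_lt h'.1 (ht.trans hlt) ht

/-- The drift agrees on a smaller disk with a bounded Lipschitz vector field on the plane. -/
theorem exists_lipschitz_eq_poissonDrift (ρ : Circle) {r : ℝ} (hr0 : 0 < r) (hr : r < 1) :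
    ∃ (F : ℂ → ℂ) (K M : ℝ≥0), LipschitzWith K F ∧ (∀ z, ‖F z‖ ≤ M) ∧
      ∀ z, ‖z‖ ≤ r → F z = poissonDrift ρ z := by
  -- The cutoff is `1` up to radius `r` and vanishes beyond `(1 + r) / 2 < 1`, so the singularity of
  -- the drift on the unit circle disappears.
  let χ : ContDiffBump (0 : ℂ) := ⟨r, (1 + r) / 2, hr0, by linarith⟩
  have hsupp : HasCompactSupport fun z ↦ χ z • poissonDrift ρ z := χ.hasCompactSupport.smul_right
  have hcd : ContDiff ℝ 1 fun z ↦ χ z • poissonDrift ρ z := by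
    rw [contDiff_iff_contDiffAt]
    intro z
    by_cases hz : z ∈ ball (0 : ℂ) 1
    · exact χ.contDiffAt.smul ((contDiffOn_poissonDrift ρ).contDiffAt (isOpen_ball.mem_nhds hz))
    · have hz' : z ∉ tsupport χ := by
        rw [χ.tsupport_eq]
        simp only [mem_ball_zero_iff, not_lt, mem_closedBall_zero_iff, not_le] at hz ⊢
        change (1 + r) / 2 < _
        linarith
      refine (contDiffAt_const (c := (0 : ℂ))).congr_of_eventuallyEq ?_
      filter_upwards [notMem_tsupport_iff_eventuallyEq.1 hz'] with y hy
      simp [hy]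
  obtain ⟨K, hK⟩ := hcd.lipschitzWith_of_hasCompactSupport hsupp one_ne_zero
  obtain ⟨M, hM⟩ := hcd.continuous.bounded_above_of_compact_support hsupp
  refine ⟨_, K, M.toNNReal, hK, fun z ↦ (hM z).trans (Real.le_coe_toNNReal M), fun z hz ↦ ?_⟩
  simp only [χ.one_of_mem_closedBall (mem_closedBall_zero_iff.2 hz), one_smul]

/-- Existence up to any given time for a bounded Lipschitz vector field translated by a path. -/
theorem exists_hasDerivWithinAt_of_lipschitz {F : ℂ → ℂ} {K M : ℝ≥0} (hF : LipschitzWith K F)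
    (hM : ∀ z, ‖F z‖ ≤ M) {u : ℝ → ℂ} (hu : Continuous u) (T : ℝ≥0) :
    ∃ α : ℝ → ℂ, α 0 = 0 ∧
      ∀ s ∈ Icc (0 : ℝ) T, HasDerivWithinAt α (F (α s + u s)) (Icc (0 : ℝ) T) s := by
  -- With speed at most `M`, the solution stays in the ball of radius `M * T` up to time `T`; this
  -- radius makes the local theorem apply on the whole interval.
  have hPL : IsPicardLindelof (fun (t : ℝ) x ↦ F (x + u t))
      (tmin := 0) (tmax := T) ⟨0, le_rfl, T.2⟩ (0 : ℂ) (M * T) 0 M K := by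
    refine ⟨fun t _ ↦ ?_, fun x _ ↦ ?_, fun t _ x _ ↦ hM _, ?_⟩
    · exact LipschitzOnWith.of_dist_le_mul fun x _ y _ ↦ by
        simpa using hF.dist_le_mul (x + u t) (y + u t)
    · exact (hF.continuous.comp (continuous_const.add hu)).continuousOn
    · simp
  exact hPL.exists_eq_forall_mem_Icc_hasDerivWithinAt₀

/-- Picard iterates for the integral equation `Y(s) = u(s) + ∫₀ˢ F(Y)`. -/
noncomputable def picardIterate (F : ℂ → ℂ) (u : ℝ → ℂ) : ℕ → ℝ → ℂ
  | 0 => u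
  | k + 1 => fun s ↦ u s + ∫ r in (0 : ℝ)..s, F (picardIterate F u k r)

theorem continuous_picardIterate {F : ℂ → ℂ} (hF : Continuous F) {u : ℝ → ℂ} (hu : Continuous u)
    (k : ℕ) : Continuous (picardIterate F u k) := by
  induction k with
  | zero => exact hu
  | succ k ih =>
    exact hu.add (intervalIntegral.continuous_primitive
      (fun a b ↦ (hF.comp ih).intervalIntegrable a b) 0)

/-- The integrand is continuous in time and measurable in `w`, hence jointly measurable, so
integrating out the time preserves measurability. -/
theorem measurable_picardIterate {W : Type*} [MeasurableSpace W] {F : ℂ → ℂ} (hF : Continuous F)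
    {u : W → ℝ → ℂ} (hu : ∀ w, Continuous (u w)) (hm : ∀ s, Measurable fun w ↦ u w s)
    (k : ℕ) (s : ℝ) : Measurable fun w ↦ picardIterate F (u w) k s := by
  induction k generalizing s with
  | zero => exact hm s
  | succ k ih =>
    have h1 : Measurable (Function.uncurry fun (r : ℝ) (w : W) ↦
        F (picardIterate F (u w) k r)) :=
      measurable_uncurry_of_continuous_of_measurable
        (fun w ↦ hF.comp (continuous_picardIterate hF (hu w) k))
        (fun r ↦ hF.measurable.comp (ih r))
    have h2 : StronglyMeasurable (Function.uncurry fun (w : W) (r : ℝ) ↦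
        F (picardIterate F (u w) k r)) := (h1.comp measurable_swap).stronglyMeasurable
    simp only [picardIterate, intervalIntegral]
    exact (hm s).add (h2.integral_prod_right.measurable.sub h2.integral_prod_right.measurable)

/-- The Picard iterates converge to the solution. -/
theorem norm_picardIterate_sub_le {F : ℂ → ℂ} {K : ℝ≥0} (hF : LipschitzWith K F) {u : ℝ → ℂ}
    (hu : Continuous u) {T : ℝ} {α : ℝ → ℂ} (h0 : α 0 = 0)
    (hα : ∀ s ∈ Icc (0 : ℝ) T, HasDerivWithinAt α (F (α s + u s)) (Icc (0 : ℝ) T) s)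
    {C : ℝ} (hC : ∀ s ∈ Icc (0 : ℝ) T, ‖α s‖ ≤ C) (k : ℕ) {s : ℝ} (hs : s ∈ Icc (0 : ℝ) T) :
    ‖picardIterate F u k s - (α s + u s)‖ ≤ C * ((K * s) ^ k / k.factorial) := by
  induction k generalizing s with
  | zero => simpa [picardIterate] using hC s hs
  | succ k ih =>
    have hsub : Icc 0 s ⊆ Icc 0 T := Icc_subset_Icc_right hs.2
    have hαc : ContinuousOn α (Icc 0 s) :=
      fun r hr ↦ (hα r (hsub hr)).continuousWithinAt.mono hsub
    have hXc : ContinuousOn (fun r ↦ F (α r + u r)) (Icc 0 s) :=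
      hF.continuous.comp_continuousOn (hαc.add hu.continuousOn)
    have hXi : IntervalIntegrable (fun r ↦ F (α r + u r)) volume 0 s :=
      ContinuousOn.intervalIntegrable (by rwa [uIcc_of_le hs.1])
    have hYi : IntervalIntegrable (fun r ↦ F (picardIterate F u k r)) volume 0 s :=
      (hF.continuous.comp (continuous_picardIterate hF.continuous hu k)).intervalIntegrable _ _
    have hint : ∫ r in (0 : ℝ)..s, F (α r + u r) = α s := by
      rw [intervalIntegral.integral_eq_sub_of_hasDerivAt_of_le hs.1 hαc (fun r hr ↦ ?_) hXi, h0,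
        sub_zero]
      exact (hα r (hsub (Ioo_subset_Icc_self hr))).hasDerivAt
        (Icc_mem_nhds hr.1 (hr.2.trans_le hs.2))
    have e : picardIterate F u (k + 1) s - (α s + u s) =
        ∫ r in (0 : ℝ)..s, (F (picardIterate F u k r) - F (α r + u r)) := by
      rw [intervalIntegral.integral_sub hYi hXi, hint]
      simp only [picardIterate]
      ring
    have hbd : ∀ r ∈ Ioc 0 s, ‖F (picardIterate F u k r) - F (α r + u r)‖ ≤
        K * (C * ((K * r) ^ k / k.factorial)) := fun r hr ↦ by
      have h1 := hF.dist_le_mul (picardIterate F u k r) (α r + u r)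
      rw [dist_eq_norm, dist_eq_norm] at h1
      exact h1.trans (mul_le_mul_of_nonneg_left (ih (hsub (Ioc_subset_Icc_self hr))) K.2)
    rw [e]
    refine (intervalIntegral.norm_integral_le_of_norm_le hs.1
      (.of_forall hbd) (Continuous.intervalIntegrable (by fun_prop) _ _)).trans (le_of_eq ?_)
    -- Integrating `r ^ k` supplies the factor `1 / (k + 1)` that turns `k!` into `(k + 1)!`.
    have e2 : (fun r : ℝ ↦ (K : ℝ) * (C * ((K * r) ^ k / k.factorial))) =
        fun r ↦ (C * K ^ (k + 1) / k.factorial) * r ^ k := by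
      ext r
      ring
    rw [e2, intervalIntegral.integral_const_mul, integral_pow, Nat.factorial_succ]
    push_cast
    have : (k.factorial : ℝ) ≠ 0 := by positivity
    field_simp
    simp [mul_pow, mul_assoc]

/-- The solution of an ordinary differential equation depends measurably on the driving path. -/
theorem measurable_of_hasDerivWithinAt {W : Type*} [MeasurableSpace W] {F : ℂ → ℂ} {K : ℝ≥0}
    (hF : LipschitzWith K F) {u : W → ℝ → ℂ} (hu : ∀ w, Continuous (u w))
    (hm : ∀ s, Measurable fun w ↦ u w s) {T : ℝ} {α : W → ℝ → ℂ} (h0 : ∀ w, α w 0 = 0)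
    (hα : ∀ w, ∀ s ∈ Icc (0 : ℝ) T,
      HasDerivWithinAt (α w) (F (α w s + u w s)) (Icc (0 : ℝ) T) s)
    {s : ℝ} (hs : s ∈ Icc (0 : ℝ) T) : Measurable fun w ↦ α w s + u w s := by
  refine measurable_of_tendsto_metrizable
    (fun k ↦ measurable_picardIterate hF.continuous hu hm k s) (tendsto_pi_nhds.2 fun w ↦ ?_)
  obtain ⟨C, hC⟩ := isCompact_Icc.exists_bound_of_continuousOn
    (f := α w) (fun r hr ↦ (hα w r hr).continuousWithinAt)
  rw [tendsto_iff_norm_sub_tendsto_zero]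
  refine squeeze_zero (fun _ ↦ norm_nonneg _)
    (fun k ↦ norm_picardIterate_sub_le hF (hu w) (h0 w) (hα w) hC k hs) ?_
  simpa using (FloorSemiring.tendsto_pow_div_factorial_atTop ((K : ℝ) * s)).const_mul C

/-! ### Comparison of the maximal solution with the auxiliary solutions. -/

namespace DiskCurve

open Classical in
/-- A solution of the differential equation on `[0, T)` gives a curve with lifetime `T`. -/
theorem exists_isSolution_of_hasDerivWithinAt {ρ : Circle} {w : ℝ≥0 → ℂ} (hw : Continuous w)
    (hw0 : w 0 = 0) {α : ℝ → ℂ} (hα0 : α 0 = 0) {T : ℝ≥0} (hT : 0 < T)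
    (hα : ∀ t : ℝ≥0, t < T → HasDerivWithinAt α (poissonDrift ρ (α t + w t)) (Ici 0) t)
    (hb : ∀ t : ℝ≥0, t < T → ‖α t + w t‖ < 1) :
    ∃ γ : DiskCurve, γ.IsSolution ρ w ∧ γ.lifetime = T ∧
      ∀ t : ℝ≥0, t < T → γ.toFun t = α t + w t := by
  refine ⟨{
    lifetime := T
    toFun := fun t ↦ if t < T then α t + w t else 0
    lifetime_pos := by simpa using hT
    continuousOn := ?_
    map_zero := by simp [hα0, hw0]
    norm_lt_one := ?_
    eq_zero := fun t ht ↦ if_neg (not_lt.2 (ENNReal.coe_le_coe.1 ht)) }, ⟨?_, ?_⟩, rfl,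
      fun t ht ↦ if_pos ht⟩
  · simp only [ENNReal.coe_lt_coe]
    refine ContinuousOn.congr (f := fun t : ℝ≥0 ↦ α t + w t) ?_ fun t ht ↦ if_pos ht
    refine ContinuousOn.add (fun t ht ↦ ?_) hw.continuousOn
    exact ((hα t ht).continuousWithinAt.comp NNReal.continuous_coe.continuousWithinAt
      fun s _ ↦ s.2)
  · intro t ht
    rw [ENNReal.coe_lt_coe] at ht
    simpa [ht] using hb t ht
  · simp [hα0, hw0]
  · intro t ht
    replace ht : t < T := ENNReal.coe_lt_coe.1 ht
    simp only [if_pos ht]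
    refine (hα t ht).congr_of_eventuallyEq ?_ (by simp [ht])
    have hnear : ∀ᶠ s : ℝ in 𝓝[Ici 0] (t : ℝ), s < T :=
      nhdsWithin_le_nhds (eventually_lt_nhds (NNReal.coe_lt_coe.2 ht))
    filter_upwards [hnear, self_mem_nhdsWithin] with s hs hs0
    rw [if_pos ((Real.toNNReal_lt_iff_lt_coe hs0).2 hs)]
    simp [Real.coe_toNNReal s hs0]

/-- If the solution for a vector field that agrees with the drift on a disk stays in a smaller disk
up to time `t`, then the maximal solution lives longer than `t` and agrees with it. -/
theorem IsMaximalSolution.lt_lifetime_of_bound {ρ : Circle} {w : ℝ≥0 → ℂ} (hw : Continuous w)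
    (hw0 : w 0 = 0) {γ : DiskCurve} (hγ : γ.IsMaximalSolution ρ w) {F : ℂ → ℂ} {r R : ℝ}
    (hrR : r < R) (hR : R < 1) (hF : ∀ z, ‖z‖ ≤ R → F z = poissonDrift ρ z) {t : ℝ≥0}
    {α : ℝ → ℂ} (hα0 : α 0 = 0)
    (hα : ∀ s ∈ Icc (0 : ℝ) (t + 1 : ℝ≥0),
      HasDerivWithinAt α (F (α s + w s.toNNReal)) (Icc (0 : ℝ) (t + 1 : ℝ≥0)) s)
    (hb : ∀ s ∈ Icc (0 : ℝ) t, ‖α s + w s.toNNReal‖ ≤ r) :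
    (t : ℝ≥0∞) < γ.lifetime ∧ γ.toFun t = α t + w t := by
  have ht1 : (t : ℝ) < (t + 1 : ℝ≥0) := by simp
  have hwc : Continuous fun s : ℝ ↦ w s.toNNReal := hw.comp continuous_real_toNNReal
  have htm : (t : ℝ) ∈ Icc (0 : ℝ) (t + 1 : ℝ≥0) := ⟨t.2, ht1.le⟩
  have hc : ContinuousWithinAt (fun s : ℝ ↦ ‖α s + w s.toNNReal‖) (Icc (0 : ℝ) (t + 1 : ℝ≥0)) t :=
    ((hα t htm).continuousWithinAt.add hwc.continuousWithinAt).norm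
  have hev := hc.eventually (eventually_lt_nhds ((hb t ⟨t.2, le_rfl⟩).trans_lt hrR))
  obtain ⟨ε, hε, hball⟩ := Metric.mem_nhdsWithin_iff.1 hev
  -- Continuity at `t` and the gap `r < R` keep the path in the disk of radius `R` slightly beyond
  -- `t`; the minimum with `1` stays inside the interval on which `α` solves the equation.
  set T : ℝ≥0 := t + min 1 ε.toNNReal with hT
  have htT : t < T := lt_add_of_pos_right t (lt_min one_pos (Real.toNNReal_pos.2 hε))
  have hbd : ∀ s : ℝ≥0, s < T → ‖α s + w s‖ < R := by
    intro s hs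
    have hs1 : (s : ℝ) < t + 1 := by
      have : s < t + 1 := hs.trans_le (add_le_add_right (min_le_left _ _) t)
      exact_mod_cast this
    have hs2 : (s : ℝ) < t + ε := by
      have : s < t + ε.toNNReal := hs.trans_le (add_le_add_right (min_le_right _ _) t)
      have := NNReal.coe_lt_coe.2 this
      rwa [NNReal.coe_add, Real.coe_toNNReal _ hε.le] at this
    rcases le_or_gt s t with h | h
    · have := hb s ⟨s.2, NNReal.coe_le_coe.2 h⟩
      rw [Real.toNNReal_coe] at this
      exact this.trans_lt hrR
    · have hst : (t : ℝ) < s := h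
      have := hball (a := (s : ℝ)) ⟨by
        rw [mem_ball, Real.dist_eq, abs_of_pos (by linarith)]
        linarith, s.2, by simpa using hs1.le⟩
      simpa using this
  obtain ⟨η, hη, hηl, hηe⟩ := exists_isSolution_of_hasDerivWithinAt (ρ := ρ) hw hw0 hα0
    (pos_of_gt htT) (fun s hs ↦ by
      have hs1 : (s : ℝ) < (t + 1 : ℝ≥0) :=
        NNReal.coe_lt_coe.2 (hs.trans_le (add_le_add_right (min_le_left _ _) t))
      have h1 := hα s ⟨s.2, hs1.le⟩
      rw [Real.toNNReal_coe, hF _ (hbd s hs).le] at h1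
      refine h1.mono_of_mem_nhdsWithin ?_
      filter_upwards [nhdsWithin_le_nhds (eventually_lt_nhds hs1), self_mem_nhdsWithin]
        with y hy hy0 using ⟨hy0, hy.le⟩) fun s hs ↦ (hbd s hs).trans hR
  have hlt : (t : ℝ≥0∞) < η.lifetime := by rw [hηl]; exact_mod_cast htT
  have hlt' := hlt.trans_le (hη.lifetime_le hγ)
  exact ⟨hlt', by rw [hγ.1.eq_of_lt hη hlt' hlt, hηe t htT]⟩

/-- A solution coincides with the solution for any Lipschitz vector field that agrees with the drift
on a disk containing it. -/
theorem IsSolution.eqOn_of_bound {ρ : Circle} {w : ℝ≥0 → ℂ} {γ : DiskCurve}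
    (hγ : γ.IsSolution ρ w) {F : ℂ → ℂ} {K : ℝ≥0} (hFK : LipschitzWith K F) {R : ℝ}
    (hF : ∀ z, ‖z‖ ≤ R → F z = poissonDrift ρ z) {t T : ℝ≥0} (htT : t ≤ T)
    {α : ℝ → ℂ} (hα0 : α 0 = 0)
    (hα : ∀ s ∈ Icc (0 : ℝ) T, HasDerivWithinAt α (F (α s + w s.toNNReal)) (Icc (0 : ℝ) T) s)
    (ht : (t : ℝ≥0∞) < γ.lifetime) (hb : ∀ s : ℝ≥0, s ≤ t → ‖γ.toFun s‖ ≤ R) :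
    ∀ s ∈ Icc (0 : ℝ) t, α s + w s.toNNReal = γ.toFun s.toNNReal := by
  have hd (s : ℝ) (hs : s ∈ Icc 0 (t : ℝ)) :
      HasDerivWithinAt (fun s : ℝ ↦ γ.toFun s.toNNReal - w s.toNNReal)
        (F (γ.toFun s.toNNReal - w s.toNNReal + w s.toNNReal)) (Ici 0) s := by
    have hst : s.toNNReal ≤ t := Real.toNNReal_le_iff_le_coe.2 hs.2
    have := hγ.2 s.toNNReal (lt_of_le_of_lt (ENNReal.coe_le_coe.2 hst) ht)
    rw [sub_add_cancel, hF _ (hb _ hst)]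
    simpa [hs.1] using this
  have hsub : Icc (0 : ℝ) t ⊆ Icc 0 (T : ℝ) := Icc_subset_Icc_right (NNReal.coe_le_coe.2 htT)
  -- Both functions solve the equation with field `F`, which is Lipschitz on the whole plane, so no
  -- a priori bound on `α` is needed.
  have hu := ODE_solution_unique_of_mem_Icc_right
    (v := fun (s : ℝ) x ↦ F (x + w s.toNNReal)) (s := fun _ ↦ univ) (K := K)
    (f := α) (g := fun s : ℝ ↦ γ.toFun s.toNNReal - w s.toNNReal) (a := 0) (b := t)
    (fun s _ ↦ LipschitzOnWith.of_dist_le_mul fun x _ y _ ↦ by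
      simpa using hFK.dist_le_mul (x + w s.toNNReal) (y + w s.toNNReal))
    (fun s hs ↦ (hα s (hsub hs)).continuousWithinAt.mono hsub)
    (fun s hs ↦ (hα s (hsub (Ico_subset_Icc_self hs))).mono_of_mem_nhdsWithin (by
      have hsT : s < T := hs.2.trans_le (NNReal.coe_le_coe.2 htT)
      filter_upwards [nhdsWithin_le_nhds (eventually_lt_nhds hsT), self_mem_nhdsWithin]
        with y hy hy0 using ⟨hs.1.trans hy0, hy.le⟩))
    (fun _ _ ↦ mem_univ _)
    (fun s hs ↦ ((hd s hs).continuousWithinAt).mono Icc_subset_Ici_self)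
    (fun s hs ↦ (hd s ⟨hs.1, hs.2.le⟩).mono (Ici_subset_Ici.2 hs.1))
    (fun _ _ ↦ mem_univ _)
    (by
      have := hγ.1
      simp [hα0, this])
  intro s hs
  rw [hu hs, sub_add_cancel]

theorem exists_norm_le_of_lt_lifetime (γ : DiskCurve) {t : ℝ≥0} (ht : (t : ℝ≥0∞) < γ.lifetime) :
    ∃ r < 1, ∀ s : ℝ≥0, s ≤ t → ‖γ.toFun s‖ ≤ r := by
  have hc : ContinuousOn (fun s ↦ ‖γ.toFun s‖) (Icc 0 t) :=
    (γ.continuousOn.mono fun s hs ↦ lt_of_le_of_lt (ENNReal.coe_le_coe.2 hs.2) ht).norm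
  obtain ⟨s₀, hs₀, hmax⟩ := isCompact_Icc.exists_isMaxOn (nonempty_Icc.2 (zero_le (a := t))) hc
  exact ⟨_, γ.norm_lt_one s₀ (lt_of_le_of_lt (ENNReal.coe_le_coe.2 hs₀.2) ht),
    fun s hs ↦ hmax ⟨zero_le, hs⟩⟩

end DiskCurve

/-! ### Measurability of the conditioned path, and the conclusion. -/

/-- The space of continuous paths in the plane started from `0`, with the σ-algebra generated by
the coordinates. -/
abbrev PathSpace : Type := {w : ℝ≥0 → ℂ // Continuous w ∧ w 0 = 0}

/-- By continuity the bound need only be tested at countably many dense times. -/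
theorem measurableSet_forall_norm_le {W : Type*} [MeasurableSpace W] {X : W → ℝ → ℂ} {t r : ℝ}
    (ht : 0 ≤ t) (hm : ∀ s ∈ Icc 0 t, Measurable fun w ↦ X w s)
    (hc : ∀ w, ContinuousOn (X w) (Icc 0 t)) :
    MeasurableSet {w | ∀ s ∈ Icc 0 t, ‖X w s‖ ≤ r} := by
  have : Nonempty (Icc 0 t) := ⟨⟨0, le_rfl, ht⟩⟩
  have e : {w | ∀ s ∈ Icc 0 t, ‖X w s‖ ≤ r} =
      ⋂ k, {w | ‖X w (TopologicalSpace.denseSeq (Icc 0 t) k)‖ ≤ r} := by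
    ext w
    simp only [mem_ofPred_eq, mem_iInter]
    refine ⟨fun h k ↦ h _ (Subtype.mem _), fun h s hs ↦ ?_⟩
    have hcl : IsClosed {s : Icc 0 t | ‖X w s‖ ≤ r} :=
      isClosed_le (continuousOn_iff_continuous_domRestrict.1 (hc w)).norm continuous_const
    exact (TopologicalSpace.denseRange_denseSeq (Icc 0 t)).induction_on
      (p := fun s : Icc 0 t ↦ ‖X w s‖ ≤ r) ⟨s, hs⟩ hcl h
  rw [e]
  exact MeasurableSet.iInter fun k ↦
    measurableSet_le (hm _ (Subtype.mem _)).norm measurable_const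

/-- The conditioned path is a measurable function of the driving path. -/
theorem measurable_conditionedPath (ρ : Circle) :
    Measurable fun w : PathSpace ↦ conditionedPath ρ w.1 := by
  refine measurable_generateFrom ?_
  rintro _ ⟨t, A, hA, rfl⟩
  have hr (n : ℕ) : (0 : ℝ) < 1 / (n + 2) ∧ (1 : ℝ) / (n + 2) < 1 := by
    refine ⟨by positivity, ?_⟩
    rw [div_lt_one (by positivity)]
    have : (0 : ℝ) ≤ n := n.cast_nonneg
    linarith
  -- The field `F n` equals the drift up to radius `1 - 1 / (2 (n + 2))`, strictly more than the
  -- radius `1 - 1 / (n + 2)` used in the events below; this gap lets the solution continue past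
  -- `t`.
  choose F K M hK hM hF using fun n : ℕ ↦ exists_lipschitz_eq_poissonDrift ρ
    (r := 1 - 1 / ((n : ℝ) + 2) / 2) (by linarith [hr n]) (by linarith [hr n])
  have hu (w : PathSpace) : Continuous fun s : ℝ ↦ w.1 s.toNNReal :=
    w.2.1.comp continuous_real_toNNReal
  have hm (s : ℝ) : Measurable fun w : PathSpace ↦ w.1 s.toNNReal :=
    (measurable_pi_apply _).comp measurable_subtype_coe
  -- Solving up to `t + 1` leaves room to show that the lifetime strictly exceeds `t`.
  choose α hα0 hα using fun (n : ℕ) (w : PathSpace) ↦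
    exists_hasDerivWithinAt_of_lipschitz (hK n) (hM n) (hu w) (t + 1)
  have ht1 : (t : ℝ) ≤ (t + 1 : ℝ≥0) := by simp
  have hsub : Icc (0 : ℝ) t ⊆ Icc (0 : ℝ) (t + 1 : ℝ≥0) := Icc_subset_Icc_right ht1
  have hXm (n : ℕ) (s : ℝ) (hs : s ∈ Icc (0 : ℝ) t) :
      Measurable fun w : PathSpace ↦ α n w s + w.1 s.toNNReal :=
    measurable_of_hasDerivWithinAt (hK n) hu hm (hα0 n) (hα n) (hsub hs)
  have hXc (n : ℕ) (w : PathSpace) :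
      ContinuousOn (fun s ↦ α n w s + w.1 s.toNNReal) (Icc (0 : ℝ) t) :=
    ContinuousOn.add (fun s hs ↦ (hα n w s (hsub hs)).continuousWithinAt.mono hsub)
      (hu w).continuousOn
  have htm : (t : ℝ) ∈ Icc (0 : ℝ) t := ⟨t.2, le_rfl⟩
  -- A curve alive at time `t` is, by compactness of `[0, t]`, inside a disk of radius `1 - 1 / (n +
  -- 2)` up to `t` for some `n`, where it agrees with the `n`-th auxiliary solution. Conversely, an
  -- auxiliary solution confined to that disk agrees with the maximal one.
  have e : (fun w : PathSpace ↦ conditionedPath ρ w.1) ⁻¹'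
      {γ : DiskCurve | (t : ℝ≥0∞) < γ.lifetime ∧ γ.toFun t ∈ A} =
      ⋃ n : ℕ, {w | ∀ s ∈ Icc (0 : ℝ) t, ‖α n w s + w.1 s.toNNReal‖ ≤ 1 - 1 / ((n : ℝ) + 2)} ∩
        {w | α n w t + w.1 (t : ℝ).toNNReal ∈ A} := by
    ext w
    have hmax := isMaximalSolution_conditionedPath ρ w.2.1 w.2.2
    simp only [mem_preimage, mem_ofPred_eq, mem_iUnion, mem_inter_iff]
    constructor
    · rintro ⟨hlt, hmem⟩
      obtain ⟨r, hr1, hb⟩ := (conditionedPath ρ w.1).exists_norm_le_of_lt_lifetime hlt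
      obtain ⟨n, hn⟩ := exists_nat_one_div_lt (sub_pos.2 hr1)
      have hn' : (1 : ℝ) / (n + 2) ≤ 1 / (n + 1) := by
        apply one_div_le_one_div_of_le <;> linarith [n.cast_nonneg (α := ℝ)]
      have heq := hmax.1.eqOn_of_bound (hK n) (hF n) (T := t + 1)
        (by simp) (hα0 n w) (hα n w) hlt (fun s hs ↦ (hb s hs).trans (by linarith [hr n]))
      refine ⟨n, fun s hs ↦ ?_, ?_⟩
      · rw [heq s hs]
        exact (hb _ (Real.toNNReal_le_iff_le_coe.2 hs.2)).trans (by linarith)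
      · rw [heq t htm, Real.toNNReal_coe]
        exact hmem
    · rintro ⟨n, hb, hmem⟩
      obtain ⟨h1, h2⟩ := hmax.lt_lifetime_of_bound w.2.1 w.2.2
        (by linarith [hr n]) (by linarith [hr n]) (hF n) (hα0 n w) (hα n w) hb
      rw [Real.toNNReal_coe] at hmem
      exact ⟨h1, h2 ▸ hmem⟩
  rw [e]
  exact MeasurableSet.iUnion fun n ↦
    (measurableSet_forall_norm_le t.2 (hXm n) (hXc n)).inter (hXm n t htm hA)

/-- A complex Brownian motion is almost surely equal to a measurable random continuous path. -/
theorem IsStandardComplexBrownian.exists_measurable_pathSpace {Ω : Type*} [MeasurableSpace Ω]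
    {P : Measure Ω} {B : ℝ≥0 → Ω → ℂ} (hB : IsStandardComplexBrownian B P) :
    ∃ W : Ω → PathSpace, Measurable W ∧ ∀ᵐ ω ∂P, (fun t ↦ B t ω) = (W ω).1 := by
  classical
  -- Each `B t` is only almost everywhere measurable. Measurable modifications are taken at
  -- countably many dense times, so the exceptional sets have a null union; other times follow by
  -- path continuity, and on a measurable null set `N` the path is replaced by `0`.
  set q := TopologicalSpace.denseSeq ℝ≥0
  have hall : ∀ᵐ ω ∂P, Continuous (B · ω) ∧ B 0 ω = 0 ∧
      ∀ k, B (q k) ω = (hB.aemeasurable (q k)).mk _ ω := by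
    filter_upwards [hB.continuous_ae, hB.zero_ae,
      ae_all_iff.2 fun k ↦ (hB.aemeasurable (q k)).ae_eq_mk] with ω h1 h2 h3 using ⟨h1, h2, h3⟩
  obtain ⟨N, hN, hNm, hN0⟩ := exists_measurable_superset_of_null (ae_iff.1 hall)
  have hgood (ω) (hω : ω ∉ N) : Continuous (B · ω) ∧ B 0 ω = 0 ∧
      ∀ k, B (q k) ω = (hB.aemeasurable (q k)).mk _ ω := by
    by_contra h
    exact hω (hN h)
  let W (ω : Ω) : PathSpace := ⟨fun t ↦ if ω ∈ N then 0 else B t ω, by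
    by_cases hω : ω ∈ N
    · simp [hω, continuous_const]
    · simpa [hω] using ⟨(hgood ω hω).1, (hgood ω hω).2.1⟩⟩
  have hq (k : ℕ) : Measurable fun ω ↦ (W ω).1 (q k) := by
    have e : (fun ω ↦ (W ω).1 (q k)) =
        fun ω ↦ if ω ∈ N then 0 else (hB.aemeasurable (q k)).mk _ ω := by
      ext ω
      by_cases hω : ω ∈ N
      · simp [W, hω]
      · simp [W, hω, (hgood ω hω).2.2 k]
    rw [e]
    exact Measurable.ite hNm measurable_const (hB.aemeasurable (q k)).measurable_mk
  refine ⟨W, (measurable_pi_lambda _ fun t ↦ ?_).subtype_mk, ?_⟩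
  · obtain ⟨x, hx, hxt⟩ := mem_closure_iff_seq_limit.1 (TopologicalSpace.denseRange_denseSeq ℝ≥0 t)
    choose k hk using hx
    refine measurable_of_tendsto_metrizable (fun n ↦ hq (k n)) (tendsto_pi_nhds.2 fun ω ↦ ?_)
    simp only [q, hk]
    exact ((W ω).2.1.tendsto t).comp hxt
  · filter_upwards [measure_eq_zero_iff_ae_notMem.1 hN0] with ω hω
    simp [W, hω]

/-- Random continuous paths are identically distributed if they are so as families of
coordinates. -/
theorem PathSpace.identDistrib {Ω : Type*} [MeasurableSpace Ω] {P : Measure Ω}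
    {W W' : Ω → PathSpace} (hW : Measurable W) (hW' : Measurable W')
    (h : IdentDistrib (fun ω ↦ (W ω).1) (fun ω ↦ (W' ω).1) P P) : IdentDistrib W W' P P where
  aemeasurable_fst := hW.aemeasurable
  aemeasurable_snd := hW'.aemeasurable
  map_eq := by
    ext S hS
    -- The subtype carries the σ-algebra pulled back from the product, so every measurable set is
    -- such a preimage.
    obtain ⟨S', hS', rfl⟩ := hS
    have h1 := h.measure_mem_eq hS'
    rw [Measure.map_apply hW (measurable_subtype_coe hS'),
      Measure.map_apply hW' (measurable_subtype_coe hS')]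
    exact h1

theorem mainTheorem6 {Ω : Type*} [MeasurableSpace Ω] (P : Measure Ω) (B : ℝ≥0 → Ω → ℂ)
    (hB : IsStandardComplexBrownian B P) (ρ₁ ρ₂ : Circle) :
    IdentDistrib (fun ω ↦ conditionedPath ρ₂ (fun t ↦ B t ω))
      (fun ω ↦ (conditionedPath ρ₁ (fun t ↦ B t ω)).rotate (ρ₂ / ρ₁)) P P := by
  obtain ⟨W, hW, hBW⟩ := hB.exists_measurable_pathSpace
  set a := ρ₂ / ρ₁ with ha
  let W' (ω : Ω) : PathSpace := ⟨fun t ↦ (W ω).1 t * a,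
    (W ω).2.1.mul continuous_const, by simp [(W ω).2.2]⟩
  have hWt (t : ℝ≥0) : Measurable fun ω ↦ (W ω).1 t :=
    (measurable_pi_apply t).comp (measurable_subtype_coe.comp hW)
  have hW't (t : ℝ≥0) : Measurable fun ω ↦ (W' ω).1 t := (hWt t).mul_const _
  have hW' : Measurable W' := (measurable_pi_lambda _ hW't).subtype_mk
  have hWB : IsStandardComplexBrownian (fun t ω ↦ (W ω).1 t) P :=
    hB.congr (by filter_upwards [hBW] with ω h t using congrFun h t)
  have hid : IdentDistrib W W' P P :=
    PathSpace.identDistrib hW hW' (hWB.identDistrib (hWB.mul_circle a) hWt hW't)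
  have h := hid.comp (measurable_conditionedPath ρ₂)
  have e1 : (fun w : PathSpace ↦ conditionedPath ρ₂ w.1) ∘ W =ᵐ[P]
      fun ω ↦ conditionedPath ρ₂ (fun t ↦ B t ω) := by
    filter_upwards [hBW] with ω hω
    simp [hω]
  have e2 : (fun w : PathSpace ↦ conditionedPath ρ₂ w.1) ∘ W' =ᵐ[P]
      fun ω ↦ (conditionedPath ρ₁ (fun t ↦ B t ω)).rotate a := by
    filter_upwards [hBW] with ω hω
    have := conditionedPath_mul ρ₁ a (W ω).2.1 (W ω).2.2
    -- Here `ρ₁ * (ρ₂ / ρ₁) = ρ₂`, so the rotated pole is `ρ₂`.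
    rw [ha, mul_div_cancel, ← ha] at this
    rw [hω]
    exact this
  exact ⟨h.aemeasurable_fst.congr e1, h.aemeasurable_snd.congr e2,
    by rw [← Measure.map_congr e1, ← Measure.map_congr e2, h.map_eq]⟩
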